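/- Let $p$ be a prime, let $\Bbbk$ be a commutative ring with $1$ of characteristic $p$ (for instance a field or a domain), and let $X=\Bbbk[x]/(x^p)$, with augmentation $\varepsilon:X\to\Bbbk$, $x\mapsto 0$, and standard derivation $\partial_x=d/dx$; tensor products are over $\Bbbk$ and $\operatorname{Der}$ denotes $\Bbbk$-linear derivations. Let $\mathcal W(X)$ be the full self-similar Lie algebra with alphabet $X$: its elements are the families $a=(a|_{X^{\otimes n}})_{n\ge0}$ of derivations of the commutative algebras $X^{\otimes n}$ such that $a(v\otimes1)=a(v)\otimes1$ for all $n$ and all $v\in X^{\otimes n}$; the bracket is the commutator, and the $p$-mapping $a\mapsto a^p$ is $p$-fold composition. As a vector space $\mathcal W(X)=\prod_{n\ge0}X^{\otimes n}\otimes\operatorname{Der}X$, where $x_1\otimes\cdots\otimes x_n\otimes\delta$ acts on $X^{\otimes N}$ by $$v_1\otimes\cdots\otimes v_N\mapsto x_1v_1\otimes\cdots\otimes x_nv_n\otimes\delta(v_{n+1})\otimes v_{n+2}\otimes\cdots\otimes v_N$$ if $N>n$, and by $0$ if $N\le n$. Write accordingly $a=(a_0,a_1,\dots)$ with $a_n\in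 X^{\otimes n}\otimes\operatorname{Der}X$. Let $\varpi_n$ be the kernel of $\varepsilon^{\otimes n}:X^{\otimes n}\to\Bbbk$. The element $a$ is *bounded* if there is $m\in\mathbb N$ such that $\varpi_n^m\,a_n=0$ for all $n\ge0$, where $X^{\otimes n}$ acts by multiplication on the left factor of $X^{\otimes n}\otimes\operatorname{Der}X$. For $\ell\in\mathbb N$, the element $a$ is *$\ell$-evanescent* if every $a_n$ is a $\Bbbk$-linear combination of tensors $x^{e_1}\otimes\cdots\otimes x^{e_n}\otimes\partial_x$ whose total degree in the last $\min\{n,\ell\}$ variables satisfies $$\sum_{\max\{n-\ell,0\}<i\le n}e_i<(p-1)\ell.$$ Fix $\ell\in\mathbb N$ and let $S\subseteq\mathcal W(X)$ be any set of elements each of which is bounded and $\ell$-evanescent. Let $\mathcal L$ be the restricted Lie subalgebra of $\mathcal W(X)$ generated by $S$ (the smallest Lie subalgebra containing $S$ and closed under $a\mapsto a^p$). Then $\mathcal L$ is nil: for every $a\in\mathcal L$ there is $n\in\mathbb N$ such that the $n$-fold iterated $p$-th power $a^{p^n}=(\cdots((a^p)^p)\cdots)^p$ is $0$. In particular, the same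 holds for every element of the ordinary Lie subalgebra generated by $S$. -/

import Mathlib

open scoped TensorProduct

noncomputable section

namespace SelfSimilar

/-! ### Componentwise Lie algebra structure on products -/

section Product

variable {ι : Type*} (L : ι → Type*) [∀ i, LieRing (L i)]

instance piLieRing : LieRing (∀ i, L i) where
  bracket a b := fun i => ⁅a i, b i⁆
  add_lie _ _ _ := funext fun _ => add_lie _ _ _
  lie_add _ _ _ := funext fun _ => lie_add _ _ _
  lie_self _ := funext fun _ => lie_self _
  leibniz_lie _ _ _ := funext fun _ => leibniz_lie _ _ _

instance piLieAlgebra (R : Type*) [CommRing R] [∀ i, LieAlgebra R (L i)] :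
    LieAlgebra R (∀ i, L i) where
  lie_smul _ _ _ := funext fun _ => lie_smul _ _ _

end Product

/-! ### Tensor powers of the alphabet -/

section General

variable (k : Type*) [CommRing k] (X : Type*) [CommRing X] [Algebra k X]

/-- The `n`-th tensor power `X ⊗ ⋯ ⊗ X` over `k`, with its componentwise (commutative)
multiplication. -/
abbrev TPow (n : ℕ) : Type _ := ⨂[k]^n X

/-- Concatenation `X^{⊗n} ⊗ X ≃ X^{⊗(n+1)}`,
`(x₁ ⊗ ⋯ ⊗ xₙ) ⊗ y ↦ x₁ ⊗ ⋯ ⊗ xₙ ⊗ y`. -/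
def concat (n : ℕ) : TPow k X n ⊗[k] X ≃ₗ[k] TPow k X (n + 1) :=
  (TensorProduct.congr (LinearEquiv.refl k (TPow k X n))
    (PiTensorProduct.subsingletonEquiv (R := k) (s := fun _ : Fin 1 => X) 0).symm).trans
    TensorPower.mulEquiv

theorem concat_tprod (n : ℕ) (v : Fin n → X) (y : X) :
    concat k X n (PiTensorProduct.tprod k v ⊗ₜ y) = PiTensorProduct.tprod k (Fin.snoc v y) := by
  have h := TensorPower.tprod_mul_tprod k v (fun _ : Fin 1 => y)
  rw [TensorPower.gMul_def] at h
  simp only [concat, LinearEquiv.trans_apply, TensorProduct.congr_tmul, LinearEquiv.refl_apply,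
    PiTensorProduct.subsingletonEquiv_symm_apply']
  rw [h, Fin.append_right_eq_snoc]

theorem concat_mul (n : ℕ) (s t : TPow k X n ⊗[k] X) :
    concat k X n (s * t) = concat k X n s * concat k X n t := by
  induction s using TensorProduct.induction_on with
  | zero => simp
  | add s₁ s₂ h₁ h₂ => simp [add_mul, h₁, h₂]
  | tmul u y =>
    induction t using TensorProduct.induction_on with
    | zero => simp
    | add t₁ t₂ h₁ h₂ => simp [mul_add, h₁, h₂]
    | tmul v z =>
      induction u using PiTensorProduct.induction_on with
      | add u₁ u₂ h₁ h₂ => simp_all [add_mul, TensorProduct.add_tmul]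
      | smul_tprod r u =>
        induction v using PiTensorProduct.induction_on with
        | add v₁ v₂ h₁ h₂ => simp_all [mul_add, TensorProduct.add_tmul]
        | smul_tprod c v =>
          simp only [← TensorProduct.smul_tmul', map_smul, smul_mul_assoc, mul_smul_comm,
            Algebra.TensorProduct.tmul_mul_tmul, PiTensorProduct.tprod_mul_tprod, concat_tprod]
          congr 3
          funext i
          refine Fin.lastCases ?_ (fun j => ?_) i <;> simp

theorem concat_one (n : ℕ) : concat k X n (1 ⊗ₜ 1) = 1 := by
  rw [PiTensorProduct.one_def, concat_tprod, PiTensorProduct.one_def]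
  congr 1
  funext i
  refine Fin.lastCases ?_ (fun j => ?_) i <;> simp

/-- The embedding `X^{⊗n} → X^{⊗(n+1)}`, `v ↦ v ⊗ 1`. -/
def extend (n : ℕ) : TPow k X n →ₗ[k] TPow k X (n + 1) :=
  (concat k X n).toLinearMap ∘ₗ (TensorProduct.mk k (TPow k X n) X).flip 1

theorem extend_apply (n : ℕ) (v : TPow k X n) : extend k X n v = concat k X n (v ⊗ₜ 1) := rfl

/-! ### The full self-similar algebra and its `p`-mapping -/

/-- The full self-similar Lie algebra `W(X)`: families `a = (a|X^{⊗n})ₙ` of derivations of the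
commutative algebras `X^{⊗n}` such that `a (v ⊗ 1) = a v ⊗ 1` for all `v ∈ X^{⊗n}`; the bracket
is the commutator. -/
def W : LieSubalgebra k (∀ n, Derivation k (TPow k X n) (TPow k X n)) where
  carrier := {a | ∀ n v, a (n + 1) (extend k X n v) = extend k X n (a n v)}
  zero_mem' := by
    intro n v
    simp
  add_mem' := by
    intro a b ha hb n v
    change a (n + 1) _ + b (n + 1) _ = extend k X n (a n v + b n v)
    rw [ha, hb, map_add]
  smul_mem' := by
    intro c a ha n v
    change c • a (n + 1) _ = extend k X n (c • a n v)
    rw [ha, map_smul]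
  lie_mem' := by
    intro a b ha hb n v
    have ha' : ∀ n v, a (n + 1) (extend k X n v) = extend k X n (a n v) := ha
    have hb' : ∀ n v, b (n + 1) (extend k X n v) = extend k X n (b n v) := hb
    change ⁅a (n + 1), b (n + 1)⁆ _ = extend k X n (⁅a n, b n⁆ v)
    simp only [Derivation.commutator_apply, ha', hb', map_sub]

variable {k X} {A : Type*} [CommRing A] [Algebra k A]

theorem iterate_prime_leibniz (p : ℕ) [hp : Fact p.Prime] [CharP k p] (D : Derivation k A A)
    (a b : A) : (⇑D)^[p] (a * b) = a * (⇑D)^[p] b + b * (⇑D)^[p] a := by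
  let d : Module.End k A := D
  let P : Module.End k (A ⊗[k] A) := TensorProduct.map d LinearMap.id
  let Q : Module.End k (A ⊗[k] A) := TensorProduct.map LinearMap.id d
  have hPQ : Commute P Q := by
    ext u v
    simp [P, Q]
  have hsemi : ∀ t, LinearMap.mul' k A ((P + Q) t) = D (LinearMap.mul' k A t) := by
    intro t
    induction t using TensorProduct.induction_on with
    | zero => simp
    | add s t hs ht => simp only [map_add, hs, ht]
    | tmul u v => simp [P, Q, d, mul_comm, add_comm]
  have hiter := Function.Semiconj.iterate_right
    (f := LinearMap.mul' k A) (ga := ⇑(P + Q)) (gb := ⇑D) hsemi p (a ⊗ₜ b)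
  have hPp : ∀ (n : ℕ) (u v : A), (P ^ n) (u ⊗ₜ v) = ((⇑D)^[n] u) ⊗ₜ v := by
    intro n
    induction n with
    | zero => simp
    | succ n ih =>
      intro u v
      rw [pow_succ, Module.End.mul_apply, Function.iterate_succ_apply, ← ih]
      rfl
  have hQp : ∀ (n : ℕ) (u v : A), (Q ^ n) (u ⊗ₜ v) = u ⊗ₜ ((⇑D)^[n] v) := by
    intro n
    induction n with
    | zero => simp
    | succ n ih =>
      intro u v
      rw [pow_succ, Module.End.mul_apply, Function.iterate_succ_apply, ← ih]
      rfl
  have hp0 : ((p : ℕ) : Module.End k (A ⊗[k] A)) = 0 := by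
    ext u v
    have : (p : k) • (u ⊗ₜ[k] v) = 0 := by rw [CharP.cast_eq_zero, zero_smul]
    rw [Nat.cast_smul_eq_nsmul] at this
    simpa [-nsmul_eq_mul, Nat.cast_smul_eq_nsmul] using this
  obtain ⟨r, hr⟩ := hPQ.exists_add_pow_prime_eq hp.out
  rw [hp0, zero_mul, zero_mul, zero_mul, add_zero] at hr
  rw [← Module.End.pow_apply, hr] at hiter
  rw [LinearMap.mul'_apply] at hiter
  rw [← hiter]
  simp [hPp, hQp, mul_comm, add_comm]

/-- In characteristic `p`, the `p`-fold composite of a derivation is a derivation. -/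
def derPow (p : ℕ) [Fact p.Prime] [CharP k p] (D : Derivation k A A) : Derivation k A A :=
  Derivation.mk' ((D : A →ₗ[k] A) ^ p : Module.End k A) (by
    intro a b
    simpa [Module.End.pow_apply] using iterate_prime_leibniz p D a b)

theorem derPow_apply (p : ℕ) [Fact p.Prime] [CharP k p] (D : Derivation k A A) (a : A) :
    derPow p D a = (⇑D)^[p] a := by
  simp [derPow, Module.End.pow_apply]

/-- The `p`-mapping `a ↦ a^p` of `W(X)`: the `p`-fold composite of `a` on every `X^{⊗n}`. -/
def pMap (p : ℕ) [Fact p.Prime] [CharP k p] (a : W k X) : W k X :=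
  ⟨fun n => derPow p (a.1 n), by
    intro n v
    have h : ∀ n v, a.1 (n + 1) (extend k X n v) = extend k X n (a.1 n v) := a.2
    rw [derPow_apply, derPow_apply]
    exact ((Function.Semiconj.iterate_right (f := extend k X n) (ga := ⇑(a.1 n))
      (gb := ⇑(a.1 (n + 1))) (fun v => (h n v).symm) p) v).symm⟩

/-- The restricted Lie subalgebra of `W(X)` generated by a set `S`: the smallest Lie subalgebra
that contains `S` and is closed under the `p`-mapping. -/
def restrictedSpan (p : ℕ) [Fact p.Prime] [CharP k p] (S : Set (W k X)) :
    LieSubalgebra k (W k X) :=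
  sInf {L | S ⊆ L ∧ ∀ a ∈ L, pMap p a ∈ L}

/-- `a` is nil: some iterated `p`-th power `a^{p^n} = (⋯(a^p)^p⋯)^p` vanishes. -/
def IsNil (p : ℕ) [Fact p.Prime] [CharP k p] (a : W k X) : Prop :=
  ∃ n : ℕ, (pMap p)^[n] a = 0

end General

/-! ### The alphabet `X = k[x]/(x^p)` -/

section Truncated

variable (k : Type*) [CommRing k] (p : ℕ)

/-- The alphabet `X = k[x]/(x^p)`. -/
abbrev Alphabet : Type _ := AdjoinRoot ((Polynomial.X : Polynomial k) ^ p)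

/-- The class of `x` in `X = k[x]/(x^p)`. -/
def x : Alphabet k p := AdjoinRoot.root _

/-- The augmentation `ε : X → k`, `x ↦ 0`. -/
def augmentation [hp : Fact p.Prime] : Alphabet k p →ₐ[k] k :=
  AdjoinRoot.liftAlgHom _ (AlgHom.id k k) 0 (by simp [hp.out.ne_zero])

/-- The augmentation `ε ⊗ ⋯ ⊗ ε : X^{⊗n} → k`. -/
def augmentationPow [Fact p.Prime] (n : ℕ) : TPow k (Alphabet k p) n →ₐ[k] k :=
  PiTensorProduct.liftAlgHom
    ((MultilinearMap.mkPiAlgebra k (Fin n) k).compLinearMap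
      fun _ => (augmentation k p).toLinearMap)
    (by simp) (by intro u v; simp [Finset.prod_mul_distrib])

/-- The augmentation ideal `ϖₙ` of `X^{⊗n}`. -/
def augIdeal [Fact p.Prime] (n : ℕ) : Ideal (TPow k (Alphabet k p) n) :=
  RingHom.ker (augmentationPow k p n)

theorem mk_derivative_eq_zero [CharP k p] (f : Polynomial k)
    (hf : AdjoinRoot.mkₐ (R := k) ((Polynomial.X : Polynomial k) ^ p) f = 0) :
    AdjoinRoot.mkₐ (R := k) ((Polynomial.X : Polynomial k) ^ p)
      (Polynomial.derivative' (R := k) f) = 0 := by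
  have h0 : AdjoinRoot.mk ((Polynomial.X : Polynomial k) ^ p) f = 0 := hf
  obtain ⟨g, rfl⟩ := AdjoinRoot.mk_eq_zero.mp h0
  refine AdjoinRoot.mk_eq_zero.mpr ⟨Polynomial.derivative g, ?_⟩
  change Polynomial.derivative _ = _
  rw [Polynomial.derivative_mul, Polynomial.derivative_X_pow]
  simp

/-- The standard derivation `∂ₓ = d/dx` of `X = k[x]/(x^p)`, in characteristic `p`. -/
def partialX [CharP k p] : Derivation k (Alphabet k p) (Alphabet k p) :=
  Derivation.liftOfSurjective
    (f := AdjoinRoot.mkₐ (R := k) ((Polynomial.X : Polynomial k) ^ p))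
    AdjoinRoot.mk_surjective (d := Polynomial.derivative') (mk_derivative_eq_zero k p)

theorem partialX_x [CharP k p] : partialX k p (x k p) = 1 := by
  have h := Derivation.liftOfSurjective_apply
    (f := AdjoinRoot.mkₐ (R := k) ((Polynomial.X : Polynomial k) ^ p))
    AdjoinRoot.mk_surjective (d := Polynomial.derivative') (mk_derivative_eq_zero k p) Polynomial.X
  exact h.trans (by simp)

theorem derivation_ext {M : Type*} [AddCommGroup M] [Module k M] [Module (Alphabet k p) M]
    [IsScalarTower k (Alphabet k p) M]
    {δ ε : Derivation k (Alphabet k p) M} (h : δ (x k p) = ε (x k p)) : δ = ε :=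
  Derivation.ext_of_adjoin_eq_top {x k p} AdjoinRoot.adjoinRoot_eq_top (by
    intro y hy
    rw [Set.mem_singleton_iff.mp hy, h])

/-- A derivation of `X = k[x]/(x^p)` is determined by its value at `x`, which is arbitrary. -/
def derEquiv [CharP k p] :
    Derivation k (Alphabet k p) (Alphabet k p) ≃ₗ[k] Alphabet k p where
  toFun δ := δ (x k p)
  map_add' _ _ := rfl
  map_smul' _ _ := rfl
  invFun f := f • partialX k p
  left_inv δ := derivation_ext k p (by simp [partialX_x])
  right_inv f := by
    simp [partialX_x]

variable {k p}

/-- The coordinate `aₙ ∈ X^{⊗n} ⊗ Der X` of `a = (a₀, a₁, …) ∈ W(X) = ∏ₙ X^{⊗n} ⊗ Der X`.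
The components `aᵢ`, `i ≠ n`, kill `1 ⊗ ⋯ ⊗ 1 ⊗ y ∈ X^{⊗(n+1)}`, whence `aₙ = ∑ uⱼ ⊗ δⱼ` is the
element with `a (1 ⊗ ⋯ ⊗ 1 ⊗ y) = ∑ uⱼ ⊗ δⱼ y` for all `y ∈ X`; it is enough to take `y = x`.
See `coord_spec`. -/
def coord [CharP k p] (a : W k (Alphabet k p)) (n : ℕ) :
    TPow k (Alphabet k p) n ⊗[k] Derivation k (Alphabet k p) (Alphabet k p) :=
  (TensorProduct.congr (LinearEquiv.refl k (TPow k (Alphabet k p) n)) (derEquiv k p)).symm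
    ((concat k (Alphabet k p) n).symm
      (a.1 (n + 1) (concat k (Alphabet k p) n (1 ⊗ₜ x k p))))

/-- The evaluation `Der X → X`, `δ ↦ δ y`. -/
def evalDer (y : Alphabet k p) :
    Derivation k (Alphabet k p) (Alphabet k p) →ₗ[k] Alphabet k p where
  toFun δ := δ y
  map_add' _ _ := rfl
  map_smul' _ _ := rfl

theorem coord_spec [CharP k p] (a : W k (Alphabet k p)) (n : ℕ) (y : Alphabet k p) :
    a.1 (n + 1) (concat k (Alphabet k p) n (1 ⊗ₜ y)) =
      concat k (Alphabet k p) n (TensorProduct.map LinearMap.id (evalDer y) (coord a n)) := by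
  have hmul : ∀ (c : TPow k (Alphabet k p) n ⊗[k]
      Derivation k (Alphabet k p) (Alphabet k p)) (y z : Alphabet k p),
      TensorProduct.map LinearMap.id (evalDer (y * z)) c =
        (1 ⊗ₜ y) * TensorProduct.map LinearMap.id (evalDer z) c +
          (1 ⊗ₜ z) * TensorProduct.map LinearMap.id (evalDer y) c := by
    intro c y z
    induction c using TensorProduct.induction_on with
    | zero => simp
    | add s t hs ht => simp only [map_add, hs, ht, mul_add]; abel
    | tmul u δ => simp [evalDer, TensorProduct.tmul_add]
  have hy : y ∈ Algebra.adjoin k {x k p} := by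
    have h : Algebra.adjoin k {x k p} = ⊤ := AdjoinRoot.adjoinRoot_eq_top
    rw [h]
    trivial
  induction hy using Algebra.adjoin_induction with
  | mem y hy =>
    rw [Set.mem_singleton_iff.mp hy]
    rw [← LinearEquiv.symm_apply_eq]
    have h := (TensorProduct.congr (LinearEquiv.refl k (TPow k (Alphabet k p) n))
      (derEquiv k p)).apply_symm_apply ((concat k (Alphabet k p) n).symm
        (a.1 (n + 1) (concat k (Alphabet k p) n (1 ⊗ₜ x k p))))
    exact h.symm
  | algebraMap r =>
    have h1 : concat k (Alphabet k p) n (1 ⊗ₜ 1) = 1 := concat_one k _ n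
    have h2 : (evalDer (algebraMap k (Alphabet k p) r) : _ →ₗ[k] Alphabet k p) = 0 := by
      ext δ
      exact δ.map_algebraMap r
    rw [h2, Algebra.algebraMap_eq_smul_one, TensorProduct.tmul_smul, map_smul, h1]
    simp
  | add y z _ _ hy hz =>
    have h2 : (evalDer (y + z) : _ →ₗ[k] Alphabet k p) = evalDer y + evalDer z := by
      ext δ
      simp [evalDer]
    simp only [h2, TensorProduct.tmul_add, map_add, hy, hz, TensorProduct.map_add_right,
      LinearMap.add_apply]
  | mul y z _ _ hy hz =>
    have h3 : (1 : TPow k (Alphabet k p) n) ⊗ₜ[k] (y * z) = (1 ⊗ₜ y) * (1 ⊗ₜ z) := by simp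
    rw [hmul, h3, concat_mul, Derivation.leibniz, hy, hz, map_add, concat_mul, concat_mul]
    simp

/-- `a` is bounded: there is a constant `m` with `ϖ^m aₙ = 0` for all `n`, where `X^{⊗n}` acts on
the left factor of `X^{⊗n} ⊗ Der X`. -/
def IsBounded [Fact p.Prime] [CharP k p] (a : W k (Alphabet k p)) : Prop :=
  ∃ m : ℕ, ∀ n : ℕ, ∀ r ∈ augIdeal k p n ^ m, r • coord a n = 0

/-- `a` is `ℓ`-evanescent: every coordinate `aₙ` is a linear combination of tensors
`x^{e₀} ⊗ ⋯ ⊗ x^{eₙ₋₁} ⊗ ∂ₓ` whose total degree in the last `min n ℓ` alphabet variables is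
less than `(p - 1) ℓ`. -/
def IsEvanescent [CharP k p] (ℓ : ℕ) (a : W k (Alphabet k p)) : Prop :=
  ∀ n : ℕ, coord a n ∈ Submodule.span k
    {t | ∃ e : Fin n → ℕ, ∑ i with n - ℓ ≤ i.1, e i < (p - 1) * ℓ ∧
      t = PiTensorProduct.tprod k (fun i => x k p ^ e i) ⊗ₜ[k] partialX k p}

end Truncated

end SelfSimilar

end

/-! Write $a=\sum_j a_j\partial_j$ with $a_j$ a combination of reduced monomials in
$x_0,\dots,x_{j-1}$. Everything is governed by the exponents $e$ of the terms $x^e\partial_j$.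
Boundedness says that the corank $(p-1)j-|e|$ is at most some $M$; evanescence says that one of the
last $\ell$ exponents is not maximal (or $j<\ell$). Applying $x^e\partial_i$ to $x^f$ yields
exponents $g=e+f-\delta_i$: this keeps evanescence and raises the corank by at most 1. So these
elements, for varying $M$, form a restricted Lie subalgebra (`boundedEvanescentSubalgebra`), and it
suffices to show that each of them is nil.

Give $x_i$ weight $\mu^i$, so that $x^e\partial_j$ has weight $\sum e_i\mu^i-\mu^j$. For $\mu<p$
close enough to $p$, evanescence forces all weights below some $-c<0$
(`BoundedEvanescent.corankWeight`). After $s$ $p$-th powers the weight is at most $-p^sc$ and the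
corank at most $M+s(p-1)$. But corank at most $M'$ and weight at most $-w$ force $w\le(M'+1)\mu^j$
(`CorankWeight.le`), so as $\mu<p$ only large $j$ survive. Once $j$ is large compared with the
corank, further $p$-th powers no longer raise the corank (`CorankWeight.carries_of_lt`), while the
weight still tends to $-\infty$. Finally all levels are so large that in any product of two terms
some exponent exceeds $p-1$ (`CorankWeight.carries_false`), and the next $p$-th power is zero. -/

open scoped TensorProduct

noncomputable section

namespace SelfSimilar

/-! ### Monomials -/

section Monomials

variable (k : Type*) [CommRing k] (p : ℕ)

/-- The monomial `∏_{i < N} xᵢ ^ eᵢ` in `X^{⊗N}`. -/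
def mon (N : ℕ) (e : ℕ → ℕ) : TPow k (Alphabet k p) N :=
  PiTensorProduct.tprod k fun i : Fin N => x k p ^ e i

/-- The variable `xᵢ` in `X^{⊗N}`. -/
def var (N i : ℕ) : TPow k (Alphabet k p) N := mon k p N (Pi.single i 1)

variable {k p}

theorem x_pow_eq_zero {m : ℕ} (h : p ≤ m) : x k p ^ m = 0 := by
  refine pow_eq_zero_of_le h ?_
  rw [x, AdjoinRoot.root, ← map_pow]
  exact AdjoinRoot.mk_self

theorem mon_congr {N : ℕ} {e f : ℕ → ℕ} (h : ∀ i < N, e i = f i) : mon k p N e = mon k p N f := by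
  unfold mon
  congr 1
  funext i
  rw [h i i.2]

theorem mon_zero (N : ℕ) : mon k p N 0 = 1 := by
  simp [mon, PiTensorProduct.one_def, Pi.one_def]

theorem mon_add (N : ℕ) (e f : ℕ → ℕ) :
    mon k p N (e + f) = mon k p N e * mon k p N f := by
  simp [mon, pow_add, Pi.mul_def]

theorem mon_sum (N : ℕ) {ι : Type*} (s : Finset ι) (e : ι → ℕ → ℕ) :
    mon k p N (∑ i ∈ s, e i) = ∏ i ∈ s, mon k p N (e i) := by
  classical
  induction s using Finset.induction_on with
  | empty => simp [mon_zero]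
  | insert i s hi ih => rw [Finset.sum_insert hi, Finset.prod_insert hi, mon_add, ih]

theorem mon_single (N i m : ℕ) : mon k p N (Pi.single i m) = var k p N i ^ m := by
  induction m with
  | zero => simp [mon_zero]
  | succ m ih => rw [pow_succ, ← ih, Pi.single_add, mon_add, var]

theorem mon_eq_prod (N : ℕ) (e : ℕ → ℕ) :
    mon k p N e = ∏ i ∈ Finset.range N, var k p N i ^ e i := by
  simp only [← mon_single, ← mon_sum]
  refine mon_congr fun i hi => ?_
  simp [Finset.sum_apply, Finset.sum_pi_single, hi]

theorem mon_eq_zero {N : ℕ} {e : ℕ → ℕ} {i : ℕ} (hi : i < N) (h : p ≤ e i) :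
    mon k p N e = 0 := by
  unfold mon
  exact MultilinearMap.map_coord_zero _ (⟨i, hi⟩ : Fin N) (x_pow_eq_zero h)

theorem extend_mon {N : ℕ} {e : ℕ → ℕ} (h : e N = 0) :
    extend k (Alphabet k p) N (mon k p N e) = mon k p (N + 1) e := by
  rw [extend_apply, mon, concat_tprod, mon]
  congr 1
  funext i
  refine Fin.lastCases ?_ (fun j => ?_) i <;> simp [h]

theorem extend_var {N i : ℕ} (h : i < N) :
    extend k (Alphabet k p) N (var k p N i) = var k p (N + 1) i :=
  extend_mon (by simp [h.ne'])

theorem concat_one_x (n : ℕ) :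
    concat k (Alphabet k p) n (1 ⊗ₜ x k p) = var k p (n + 1) n := by
  rw [PiTensorProduct.one_def, concat_tprod, var, mon]
  congr 1
  funext i
  refine Fin.lastCases ?_ (fun j => ?_) i
  · simp
  · simp [j.2.ne]

/-! ### Derivations on monomials, and spans of reduced monomials -/

theorem derivation_prod {A ι : Type*} [CommRing A] [Algebra k A] [DecidableEq ι]
    (D : Derivation k A A) (s : Finset ι) (g : ι → A) :
    D (∏ i ∈ s, g i) = ∑ i ∈ s, (∏ j ∈ s.erase i, g j) * D (g i) := by
  induction s using Finset.induction_on with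
  | empty => simp
  | insert a s ha ih =>
    rw [Finset.prod_insert ha, Derivation.leibniz, ih, Finset.sum_insert ha,
      Finset.erase_insert ha, smul_eq_mul, smul_eq_mul, Finset.mul_sum, add_comm]
    congr 1
    refine Finset.sum_congr rfl fun i hi => ?_
    rw [Finset.erase_insert_of_ne (by rintro rfl; exact ha hi),
      Finset.prod_insert (by simp [ha]), mul_assoc]

theorem derivation_mon {N : ℕ} (D : Derivation k (TPow k (Alphabet k p) N)
    (TPow k (Alphabet k p) N)) (f : ℕ → ℕ) :
    D (mon k p N f) = ∑ i ∈ Finset.range N,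
      f i • (mon k p N (Function.update f i (f i - 1)) * D (var k p N i)) := by
  rw [mon_eq_prod, derivation_prod]
  refine Finset.sum_congr rfl fun i hi => ?_
  rw [Derivation.leibniz_pow, mon_eq_prod, ← Finset.mul_prod_erase _ _ hi,
    Function.update_self, mul_smul_comm, smul_eq_mul, mul_left_comm, mul_assoc]
  congr 2
  congr 1
  refine Finset.prod_congr rfl fun j hj => ?_
  rw [Function.update_of_ne (Finset.ne_of_mem_erase hj)]

/-- The span in `X^{⊗N}` of the reduced monomials in `x₀, …, xⱼ₋₁` whose exponents satisfy `P`. -/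
def monSpan (k : Type*) [CommRing k] (p N j : ℕ) (P : (ℕ → ℕ) → Prop) :
    Submodule k (TPow k (Alphabet k p) N) :=
  Submodule.span k {t | ∃ e : ℕ → ℕ, (∀ i, e i < p) ∧ (∀ i, j ≤ i → e i = 0) ∧ P e ∧
    t = mon k p N e}

theorem mon_mem_monSpan {N j : ℕ} {P : (ℕ → ℕ) → Prop} {e : ℕ → ℕ} (h₁ : ∀ i, e i < p)
    (h₂ : ∀ i, j ≤ i → e i = 0) (h₃ : P e) : mon k p N e ∈ monSpan k p N j P :=
  Submodule.subset_span ⟨e, h₁, h₂, h₃, rfl⟩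

theorem monSpan_mono {N j : ℕ} {P Q : (ℕ → ℕ) → Prop}
    (h : ∀ e, (∀ i, e i < p) → (∀ i, j ≤ i → e i = 0) → P e → Q e) :
    monSpan k p N j P ≤ monSpan k p N j Q :=
  Submodule.span_mono fun _ ⟨e, h₁, h₂, h₃, h₄⟩ => ⟨e, h₁, h₂, h e h₁ h₂ h₃, h₄⟩

theorem monSpan_false (N j : ℕ) : monSpan k p N j (fun _ => False) = ⊥ := by
  simp [monSpan]

theorem extend_mem_monSpan {N j : ℕ} (hj : j ≤ N) {P : (ℕ → ℕ) → Prop}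
    {t : TPow k (Alphabet k p) N} (ht : t ∈ monSpan k p N j P) :
    extend k (Alphabet k p) N t ∈ monSpan k p (N + 1) j P := by
  have : monSpan k p N j P ≤ (monSpan k p (N + 1) j P).comap (extend k (Alphabet k p) N) := by
    refine Submodule.span_le.mpr ?_
    rintro _ ⟨e, h₁, h₂, h₃, rfl⟩
    change extend k _ N _ ∈ monSpan k p (N + 1) j P
    rw [extend_mon (h₂ N hj)]
    exact mon_mem_monSpan h₁ h₂ h₃
  exact this ht

/-! ### The monomial basis -/

/-- Extension of a tuple of exponents by zero. -/
def padZero {p n : ℕ} (e : Fin n → Fin p) (i : ℕ) : ℕ := if h : i < n then e ⟨i, h⟩ else 0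

theorem padZero_coe {n : ℕ} (e : Fin n → Fin p) (i : Fin n) : padZero e i = e i := by
  simp [padZero]

theorem padZero_lt [NeZero p] {n : ℕ} (e : Fin n → Fin p) (i : ℕ) : padZero e i < p := by
  unfold padZero
  split_ifs
  · exact Fin.isLt _
  · exact Nat.pos_of_neZero p

theorem padZero_eq_zero {n : ℕ} (e : Fin n → Fin p) (i : ℕ) (h : n ≤ i) : padZero e i = 0 := by
  simp [padZero, h.not_gt]

theorem exists_padZero {n : ℕ} {e : ℕ → ℕ} (h₁ : ∀ i, e i < p) (h₂ : ∀ i, n ≤ i → e i = 0) :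
    ∃ f : Fin n → Fin p, padZero f = e := by
  refine ⟨fun i => ⟨e i, h₁ i⟩, funext fun i => ?_⟩
  unfold padZero
  split_ifs with h
  · rfl
  · exact (h₂ i (not_lt.mp h)).symm

variable (k p) in
/-- The basis `1, x, …, x^{p-1}` of `X`. -/
def alphabetBasis [Nontrivial k] : Module.Basis (Fin p) k (Alphabet k p) :=
  (AdjoinRoot.powerBasis' (Polynomial.monic_X_pow p)).basis.reindex
    (finCongr (by simp))

theorem alphabetBasis_apply [Nontrivial k] (i : Fin p) : alphabetBasis k p i = x k p ^ (i : ℕ) := by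
  simp [alphabetBasis, x]

variable (k p) in
/-- The basis of reduced monomials of `X^{⊗n}`. -/
def monBasis [Nontrivial k] (n : ℕ) : Module.Basis (Fin n → Fin p) k (TPow k (Alphabet k p) n) :=
  Basis.piTensorProduct fun _ => alphabetBasis k p

theorem monBasis_apply [Nontrivial k] {n : ℕ} (e : Fin n → Fin p) :
    monBasis k p n e = mon k p n (padZero e) := by
  simp [monBasis, Basis.piTensorProduct_apply, alphabetBasis_apply, mon, padZero_coe]

theorem mem_monSpan_iff [Nontrivial k] [NeZero p] {n : ℕ} {P : (ℕ → ℕ) → Prop}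
    {t : TPow k (Alphabet k p) n} :
    t ∈ monSpan k p n n P ↔ ∀ e, (monBasis k p n).repr t e ≠ 0 → P (padZero e) := by
  have : monSpan k p n n P = Submodule.span k (monBasis k p n '' {e | P (padZero e)}) := by
    unfold monSpan
    congr 1
    ext t
    constructor
    · rintro ⟨e, h₁, h₂, h₃, rfl⟩
      obtain ⟨f, rfl⟩ := exists_padZero h₁ h₂
      exact ⟨f, h₃, monBasis_apply f⟩
    · rintro ⟨e, he, rfl⟩
      exact ⟨padZero e, padZero_lt e, padZero_eq_zero e, he, monBasis_apply e⟩
  rw [this, Module.Basis.mem_span_image]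
  simp [Set.subset_def]

/-! ### Coordinates supported on prescribed monomials -/

section Support

variable {P Q : ℕ → (ℕ → ℕ) → Prop}

/-- `a = ∑ⱼ aⱼ ∂ⱼ`, where every `aⱼ` is a linear combination of reduced monomials in
`x₀, …, xⱼ₋₁` whose exponents satisfy `P j`. -/
def HasSupport (P : ℕ → (ℕ → ℕ) → Prop) (a : W k (Alphabet k p)) : Prop :=
  ∀ j, a.1 (j + 1) (var k p (j + 1) j) ∈ monSpan k p (j + 1) j (P j)

theorem HasSupport.mono {a : W k (Alphabet k p)} (ha : HasSupport P a)
    (h : ∀ j e, (∀ i, e i < p) → (∀ i, j ≤ i → e i = 0) → P j e → Q j e) : HasSupport Q a :=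
  fun j => monSpan_mono (h j) (ha j)

theorem HasSupport.apply_var {a : W k (Alphabet k p)} (ha : HasSupport P a) {N j : ℕ}
    (hj : j < N) : a.1 N (var k p N j) ∈ monSpan k p N j (P j) := by
  induction N, hj using Nat.le_induction with
  | base => exact ha j
  | succ N hN ih =>
    have h : a.1 (N + 1) (extend k _ N (var k p N j)) = extend k _ N (a.1 N (var k p N j)) :=
      a.2 N _
    rw [extend_var hN] at h
    rw [h]
    exact extend_mem_monSpan (Nat.le_of_succ_le hN) ih

/-- The action of derivations with support `P` carries monomials with exponents in `R`
to combinations of monomials with exponents in `R'`. -/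
def Carries (p : ℕ) (P : ℕ → (ℕ → ℕ) → Prop) (j : ℕ) (R R' : (ℕ → ℕ) → Prop) : Prop :=
  ∀ i < j, ∀ e f g : ℕ → ℕ, (∀ l, i ≤ l → e l = 0) → P i e → (∀ l, j ≤ l → f l = 0) → R f →
    (∀ l, e l < p) → (∀ l, f l < p) → (∀ l, g l < p) → g + Pi.single i 1 = e + f → R' g

/-- By the Leibniz rule, all terms of $a(x^f)$ have exponents $e+f-\delta_i$ with $f_i>0$ and $e$ in
the support at $i$. `Carries` writes this as an equality of sums, to avoid truncated subtraction,
and may assume that the result is reduced since other monomials vanish. -/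
theorem HasSupport.apply_mem {a : W k (Alphabet k p)} (ha : HasSupport P a) {N j : ℕ}
    (hj : j ≤ N) {R R' : (ℕ → ℕ) → Prop} (h : Carries p P j R R') {t : TPow k (Alphabet k p) N}
    (ht : t ∈ monSpan k p N j R) : a.1 N t ∈ monSpan k p N j R' := by
  suffices monSpan k p N j R ≤ (monSpan k p N j R').comap (a.1 N).toLinearMap from
    this ht
  refine Submodule.span_le.mpr ?_
  rintro _ ⟨f, hf₁, hf₂, hf₃, rfl⟩
  change a.1 N _ ∈ monSpan k p N j R'
  rw [derivation_mon]
  refine Submodule.sum_mem _ fun i hi => ?_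
  rw [Finset.mem_range] at hi
  rcases Nat.eq_zero_or_pos (f i) with hfi | hfi
  · simp [hfi]
  have hij : i < j := by
    by_contra hij
    exact hfi.ne' (hf₂ i (not_lt.mp hij))
  refine Submodule.smul_of_tower_mem _ _ ?_
  suffices monSpan k p N i (P i) ≤ (monSpan k p N j R').comap
      (LinearMap.mulLeft k (mon k p N (Function.update f i (f i - 1)))) from
    this (ha.apply_var hi)
  refine Submodule.span_le.mpr ?_
  rintro _ ⟨e, he₁, he₂, he₃, rfl⟩
  change mon k p N _ * mon k p N e ∈ monSpan k p N j R'
  rw [← mon_add]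
  by_cases hred : ∀ l < N, (Function.update f i (f i - 1) + e) l < p
  · have hvan : ∀ l, j ≤ l → (Function.update f i (f i - 1) + e) l = 0 := fun l hl => by
      rw [Pi.add_apply, Function.update_of_ne (hij.trans_le hl).ne', hf₂ l hl,
        he₂ l (hij.le.trans hl)]
    have hlt : ∀ l, (Function.update f i (f i - 1) + e) l < p := fun l => by
      rcases lt_or_ge l N with hl | hl
      · exact hred l hl
      · rw [hvan l (hj.trans hl)]
        exact (Nat.zero_le _).trans_lt (hf₁ 0)
    refine mon_mem_monSpan hlt hvan (h i hij e f _ he₂ he₃ hf₂ hf₃ he₁ hf₁ hlt ?_)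
    funext l
    rcases eq_or_ne l i with rfl | hl
    · simp only [Pi.add_apply, Function.update_self, Pi.single_eq_same]
      omega
    · simp [hl, add_comm]
  · push Not at hred
    obtain ⟨l, hl, hpl⟩ := hred
    rw [mon_eq_zero hl hpl]
    exact Submodule.zero_mem _

/-- `R t j` bounds the exponents of $a^{t+1}(x_j)$, hence the index $p-1$ for $a^p$ and only $p-1$
uses of `Carries`. -/
theorem HasSupport.pMap [Fact p.Prime] [CharP k p] {a : W k (Alphabet k p)} (ha : HasSupport P a)
    (R : ℕ → ℕ → (ℕ → ℕ) → Prop) (h₀ : ∀ j e, P j e → R 0 j e)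
    (h : ∀ t j, t + 1 < p → Carries p P j (R t j) (R (t + 1) j)) :
    HasSupport (R (p - 1)) (pMap p a) := by
  intro j
  change derPow p (a.1 (j + 1)) _ ∈ monSpan k p (j + 1) j (R (p - 1) j)
  rw [derPow_apply]
  have key : ∀ t, t < p → (⇑(a.1 (j + 1)))^[t + 1] (var k p (j + 1) j) ∈
      monSpan k p (j + 1) j (R t j) := by
    intro t
    induction t with
    | zero => exact fun _ => monSpan_mono (fun e _ _ => h₀ j e) (ha j)
    | succ t ih =>
      intro ht
      rw [Function.iterate_succ_apply']
      exact ha.apply_mem (Nat.le_succ j) (h t j ht) (ih (Nat.lt_of_succ_lt ht))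
  have hp : 0 < p := (Fact.out : p.Prime).pos
  have := key (p - 1) (by omega)
  rwa [Nat.sub_add_cancel hp] at this

theorem HasSupport.eq_zero [Nontrivial k] [NeZero p] {a : W k (Alphabet k p)}
    (ha : HasSupport (fun _ _ => False) a) : a = 0 := by
  refine Subtype.ext (funext fun N => Derivation.ext fun t => ?_)
  have ht : t ∈ monSpan k p N N (fun _ => True) := mem_monSpan_iff.mpr fun _ _ => trivial
  have h := ha.apply_mem le_rfl (R' := fun _ => False) (fun i _ e f g _ h => h.elim) ht
  rw [monSpan_false, Submodule.mem_bot] at h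
  exact h

theorem HasSupport.zero : HasSupport P (0 : W k (Alphabet k p)) := fun j =>
  Submodule.zero_mem (monSpan k p (j + 1) j (P j))

theorem HasSupport.add {a b : W k (Alphabet k p)} (ha : HasSupport P a) (hb : HasSupport P b) :
    HasSupport P (a + b) := fun j => Submodule.add_mem _ (ha j) (hb j)

theorem HasSupport.smul {a : W k (Alphabet k p)} (c : k) (ha : HasSupport P a) :
    HasSupport P (c • a) := fun j => Submodule.smul_mem _ c (ha j)

theorem HasSupport.lie {a b : W k (Alphabet k p)} (ha : HasSupport P a) (hb : HasSupport P b)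
    (h : ∀ j, Carries p P j (P j) (Q j)) : HasSupport Q ⁅a, b⁆ := fun j => by
  change ⁅a.1 (j + 1), b.1 (j + 1)⁆ _ ∈ monSpan k p (j + 1) j (Q j)
  rw [Derivation.commutator_apply]
  exact Submodule.sub_mem _ (ha.apply_mem (Nat.le_succ j) (h j) (hb j))
    (hb.apply_mem (Nat.le_succ j) (h j) (ha j))

end Support

end Monomials

section Bounded

variable {k : Type*} [CommRing k] {p : ℕ}

/-! ### Bounded and evanescent elements -/

theorem augmentation_x [Fact p.Prime] : augmentation k p (x k p) = 0 := by
  simp [augmentation, x]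

theorem augmentationPow_tprod [Fact p.Prime] {n : ℕ} (v : Fin n → Alphabet k p) :
    augmentationPow k p n (PiTensorProduct.tprod k v) = ∏ i, augmentation k p (v i) := by
  simp [augmentationPow, PiTensorProduct.liftAlgHom]

theorem var_mem_augIdeal [Fact p.Prime] {n i : ℕ} (hi : i < n) :
    var k p n i ∈ augIdeal k p n := by
  rw [augIdeal, RingHom.mem_ker, var, mon]
  refine (augmentationPow_tprod _).trans (Finset.prod_eq_zero (Finset.mem_univ ⟨i, hi⟩) ?_)
  simp [augmentation_x]

theorem mon_mem_augIdeal_pow [Fact p.Prime] {n m : ℕ} {e : ℕ → ℕ}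
    (h : m ≤ ∑ i ∈ Finset.range n, e i) : mon k p n e ∈ augIdeal k p n ^ m := by
  refine Ideal.pow_le_pow_right h ?_
  rw [mon_eq_prod, ← Finset.prod_pow_eq_pow_sum]
  exact Ideal.prod_mem_prod fun i hi =>
    Ideal.pow_mem_pow (var_mem_augIdeal (Finset.mem_range.mp hi)) _

/-- Duality with respect to the socle: $x^{p-1-e}x^f$ is the top monomial if $f=e$, a lower one if
$f\le e$ otherwise, and zero if $f\not\le e$. So multiplication by the complementary monomial reads
off the coefficient of $x^e$ in top degree; `Fin.rev 0` stands for $p-1$. -/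
theorem repr_mon_rev_mul [Fact p.Prime] [Nontrivial k] {n : ℕ} (e : Fin n → Fin p)
    (g : TPow k (Alphabet k p) n) :
    (monBasis k p n).repr (mon k p n (padZero fun i => (e i).rev) * g) (fun _ => Fin.rev 0) =
      (monBasis k p n).repr g e := by
  suffices (monBasis k p n).coord (fun _ => Fin.rev 0) ∘ₗ
      LinearMap.mulLeft k (mon k p n (padZero fun i => (e i).rev)) = (monBasis k p n).coord e from
    LinearMap.congr_fun this g
  refine (monBasis k p n).ext fun f => ?_
  simp only [LinearMap.comp_apply, LinearMap.mulLeft_apply, Module.Basis.coord_apply,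
    monBasis_apply f, ← mon_add]
  rw [← monBasis_apply f, Module.Basis.repr_self]
  by_cases h : ∀ i, f i ≤ e i
  · have : mon k p n ((padZero fun i => (e i).rev) + padZero f) =
        monBasis k p n fun i => Fin.rev ⟨e i - f i, (Nat.sub_le _ _).trans_lt (e i).2⟩ := by
      rw [monBasis_apply]
      refine mon_congr fun i hi => ?_
      have h₁ := h ⟨i, hi⟩
      have h₂ := (e ⟨i, hi⟩).2
      rw [Fin.le_def] at h₁
      simp only [Pi.add_apply, padZero, hi, dif_pos, Fin.val_rev]
      omega
    rw [this, Module.Basis.repr_self, Finsupp.single_apply, Finsupp.single_apply]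
    refine if_congr ?_ rfl rfl
    simp only [funext_iff, Fin.rev_inj]
    refine forall_congr' fun i => ?_
    have := h i
    rw [Fin.le_def] at this
    simp only [Fin.ext_iff, Fin.val_zero]
    omega
  · push Not at h
    obtain ⟨i, hi⟩ := h
    rw [mon_eq_zero i.2, map_zero, Finsupp.single_eq_of_ne]
    · simp
    · rintro rfl
      exact hi.false
    · have := (e i).2
      rw [Fin.lt_def] at hi
      simp only [Pi.add_apply, padZero_coe, Fin.val_rev]
      omega

/-- An exponent is evanescent at level `j` if one of the last `ℓ` exponents below `j`
is not maximal. -/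
def Evanescent (p ℓ j : ℕ) (e : ℕ → ℕ) : Prop :=
  j < ℓ ∨ ∃ i < j, j ≤ i + ℓ ∧ e i < p - 1

/-- The exponents occurring in a bounded evanescent element. -/
def BoundedEvanescent (p ℓ M j : ℕ) (e : ℕ → ℕ) : Prop :=
  (p - 1) * j ≤ ∑ i ∈ Finset.range j, e i + M ∧ Evanescent p ℓ j e

theorem evanescent_of_sum_lt {ℓ n : ℕ} {e : ℕ → ℕ}
    (h : ∑ i : Fin n with n - ℓ ≤ i.1, e i < (p - 1) * ℓ) : Evanescent p ℓ n e := by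
  by_contra hc
  simp only [Evanescent, not_or, not_lt, not_exists, not_and] at hc
  refine h.not_ge ?_
  rw [Finset.sum_filter, Fin.sum_univ_eq_sum_range (fun i => if n - ℓ ≤ i then e i else 0),
    ← Finset.sum_filter]
  have hcard : (Finset.filter (fun i => n - ℓ ≤ i) (Finset.range n)).card = ℓ := by
    have : Finset.filter (fun i => n - ℓ ≤ i) (Finset.range n) = Finset.Ico (n - ℓ) n := by
      ext i
      simp [and_comm]
    rw [this, Nat.card_Ico]
    omega
  have := Finset.card_nsmul_le_sum (Finset.filter (fun i => n - ℓ ≤ i) (Finset.range n)) e (p - 1)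
    (fun i hi => by
      rw [Finset.mem_filter, Finset.mem_range] at hi
      exact hc.2 i hi.1 (by omega))
  rwa [hcard, smul_eq_mul, mul_comm] at this

theorem exists_coord_eq [Fact p.Prime] [CharP k p] {ℓ : ℕ} {a : W k (Alphabet k p)}
    (ha : IsEvanescent ℓ a) (n : ℕ) :
    ∃ g ∈ monSpan k p n n (Evanescent p ℓ n), g ⊗ₜ partialX k p = coord a n := by
  have hp : 0 < p := (Fact.out : p.Prime).pos
  suffices h : coord a n ∈ (monSpan k p n n (Evanescent p ℓ n)).map
      ((TensorProduct.mk k (TPow k (Alphabet k p) n) _).flip (partialX k p)) from h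
  refine Submodule.span_le.mpr ?_ (ha n)
  rintro _ ⟨e, he, rfl⟩
  by_cases h : ∀ i, e i < p
  · let f : Fin n → Fin p := fun i => ⟨e i, h i⟩
    have : NeZero p := ⟨hp.ne'⟩
    refine ⟨mon k p n (padZero f), mon_mem_monSpan (padZero_lt f) (padZero_eq_zero f)
      (evanescent_of_sum_lt ?_), ?_⟩
    · simpa only [padZero_coe, f] using he
    · simp [mon, padZero_coe, f]
  · push Not at h
    obtain ⟨i, hi⟩ := h
    have : PiTensorProduct.tprod k (fun i => x k p ^ e i) = 0 :=
      MultilinearMap.map_coord_zero _ i (x_pow_eq_zero hi)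
    rw [this, TensorProduct.zero_tmul]
    exact Submodule.zero_mem _

/-- Since $\partial_x x=1$, the functional $\delta\mapsto\varepsilon(\delta x)$ on the right factor
recovers $g$. -/
theorem eq_zero_of_tmul_partialX [Fact p.Prime] [CharP k p] {n : ℕ}
    {g : TPow k (Alphabet k p) n} (h : g ⊗ₜ[k] partialX k p = 0) : g = 0 := by
  have := congrArg (TensorProduct.rid k _ ∘ TensorProduct.map LinearMap.id
    ((augmentation k p).toLinearMap ∘ₗ evalDer (x k p))) h
  simpa [evalDer, partialX_x] using this

theorem exists_hasSupport [Fact p.Prime] [CharP k p] {ℓ : ℕ} {a : W k (Alphabet k p)}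
    (hb : IsBounded a) (he : IsEvanescent ℓ a) :
    ∃ M, HasSupport (BoundedEvanescent p ℓ M) a := by
  have hp : p.Prime := Fact.out
  have : Nontrivial k := CharP.nontrivial_of_char_ne_one hp.ne_one
  obtain ⟨m, hm⟩ := hb
  refine ⟨m, fun n => ?_⟩
  obtain ⟨g, hg, hgc⟩ := exists_coord_eq he n
  have hext : a.1 (n + 1) (var k p (n + 1) n) = extend k _ n g := by
    rw [← concat_one_x, coord_spec, ← hgc]
    simp [evalDer, partialX_x, extend_apply]
  rw [hext]
  refine extend_mem_monSpan le_rfl (mem_monSpan_iff.mpr fun e hne => ⟨?_, ?_⟩)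
  · by_contra hlt
    refine hne ?_
    -- If $|e|<(p-1)n-m$, the complementary monomial has degree at least $m$, so it lies in
    -- $\varpi_n^m$ and kills $g$; then the coefficient of $x^e$ in $g$ is zero.
    have hmem : mon k p n (padZero fun i => (e i).rev) ∈ augIdeal k p n ^ m := by
      refine mon_mem_augIdeal_pow ?_
      have : ∑ i ∈ Finset.range n, (padZero (fun i => (e i).rev) i + padZero e i) =
          ∑ i ∈ Finset.range n, (p - 1) := by
        refine Finset.sum_congr rfl fun i hi => ?_
        have hi' := Finset.mem_range.mp hi
        have := (e ⟨i, hi'⟩).2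
        simp only [padZero, hi', dif_pos, Fin.val_rev]
        omega
      rw [Finset.sum_add_distrib, Finset.sum_const, Finset.card_range, smul_eq_mul,
        mul_comm] at this
      omega
    have h := hm n _ hmem
    rw [← hgc, TensorProduct.smul_tmul', smul_eq_mul] at h
    rw [← repr_mon_rev_mul, eq_zero_of_tmul_partialX h]
    simp
  · exact mem_monSpan_iff.mp hg e hne

end Bounded

/-! ### Effect of $x^e\partial_i$ on degree and evanescence -/

section Carries

variable {p : ℕ} {i j : ℕ} {e f g : ℕ → ℕ}

/-- Used with $w=1$ over `ℕ` for the corank, and with $w_l=\mu^l$ over `ℝ` for the weight. -/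
theorem sum_mul_of_add_single_eq {R : Type*} [CommSemiring R] (w : ℕ → R) (hij : i < j)
    (he : ∀ l, i ≤ l → e l = 0) (h : g + Pi.single i 1 = e + f) :
    ∑ l ∈ Finset.range j, (g l : R) * w l + w i =
      ∑ l ∈ Finset.range i, (e l : R) * w l + ∑ l ∈ Finset.range j, (f l : R) * w l := by
  have h₁ : ∑ l ∈ Finset.range i, (e l : R) * w l = ∑ l ∈ Finset.range j, (e l : R) * w l := by
    refine Finset.sum_subset (Finset.range_mono hij.le) fun l _ hl => ?_
    rw [he l (by simpa using hl), Nat.cast_zero, zero_mul]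
  have h₂ : w i = ∑ l ∈ Finset.range j, ((Pi.single i 1 : ℕ → ℕ) l : R) * w l := by
    rw [Finset.sum_eq_single_of_mem i (Finset.mem_range.mpr hij)]
    · simp
    · intro l _ hl
      simp [hl]
  rw [h₁, h₂, ← Finset.sum_add_distrib, ← Finset.sum_add_distrib]
  refine Finset.sum_congr rfl fun l _ => ?_
  rw [← add_mul, ← add_mul, ← Nat.cast_add, ← Nat.cast_add]
  exact congrArg (fun q : ℕ => (q : R) * w l) (congrFun h l)

theorem sum_of_add_single_eq (hij : i < j) (he : ∀ l, i ≤ l → e l = 0)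
    (h : g + Pi.single i 1 = e + f) :
    ∑ l ∈ Finset.range j, g l + 1 = ∑ l ∈ Finset.range i, e l + ∑ l ∈ Finset.range j, f l := by
  simpa using sum_mul_of_add_single_eq (R := ℕ) 1 hij he h

/-- Let $l$ be the position of a non-maximal exponent of $f$. If $l\ge i$, then $e_l=0$ and the
exponent does not grow. If $l<i$, then $i$ is a new such position, still among the last $\ell$,
since $\partial_i$ has lowered $f_i$ and $e_i=0$. -/
theorem Evanescent.of_add_single_eq {ℓ : ℕ} (hf : Evanescent p ℓ j f) (hij : i < j)
    (he : ∀ l, i ≤ l → e l = 0) (hfp : ∀ l, f l < p) (h : g + Pi.single i 1 = e + f) :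
    Evanescent p ℓ j g := by
  have hg : ∀ l, g l + (Pi.single i 1 : ℕ → ℕ) l = e l + f l := fun l => congrFun h l
  rcases hf with hf | ⟨l, hlj, hl, hfl⟩
  · exact Or.inl hf
  rcases le_or_gt i l with hil | hil
  · refine Or.inr ⟨l, hlj, hl, ?_⟩
    have := hg l
    rw [he l hil] at this
    omega
  · refine Or.inr ⟨i, hij, by omega, ?_⟩
    have := hg i
    rw [he i le_rfl, Pi.single_eq_same] at this
    have := hfp i
    omega

theorem BoundedEvanescent.carries {ℓ M M' : ℕ} {P : ℕ → (ℕ → ℕ) → Prop} (hM : M + 1 ≤ M') :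
    Carries p P j (BoundedEvanescent p ℓ M j) (BoundedEvanescent p ℓ M' j) := by
  intro i hij e f g he _ _ hf _ hfp _ h
  refine ⟨?_, hf.2.of_add_single_eq hij he hfp h⟩
  have h₁ := sum_of_add_single_eq hij he h
  have h₂ := hf.1
  omega

theorem BoundedEvanescent.mono {ℓ M M' : ℕ} (hM : M ≤ M') (h : BoundedEvanescent p ℓ M j f) :
    BoundedEvanescent p ℓ M' j f :=
  ⟨h.1.trans (by omega), h.2⟩

end Carries

/-! ### Weights -/

section Weight

variable {p : ℕ} {j : ℕ} {μ : ℝ} {e f g : ℕ → ℕ}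

/-- The monomials `xᵉ` of corank at most `M` for which `xᵉ ∂ⱼ` has weight at most `-w`,
where `xᵢ` has weight `μ ^ i`. -/
def CorankWeight (p : ℕ) (μ : ℝ) (M : ℕ) (w : ℝ) (j : ℕ) (e : ℕ → ℕ) : Prop :=
  (p - 1) * j ≤ ∑ i ∈ Finset.range j, e i + M ∧
    ∑ i ∈ Finset.range j, (e i : ℝ) * μ ^ i + w ≤ μ ^ j

theorem sub_one_mul_sum_sub_one (p j : ℕ) (μ : ℝ) :
    (μ - 1) * ∑ i ∈ Finset.range j, ((p : ℝ) - 1) * μ ^ i = (p - 1) * (μ ^ j - 1) := by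
  rw [← Finset.mul_sum, ← geom_sum_mul]
  ring

/-- With all exponents equal to $p-1$ the monomial weighs $(p-1)(\mu^j-1)/(\mu-1)$, which exceeds
$\mu^j-(p-\mu)/(\mu-1)$ by $(p-\mu)\mu^j/(\mu-1)-1$. A non-maximal exponent at $i\ge j-\ell$ saves
$\mu^i$, which compensates because $(p-\mu)\mu^\ell\le\mu-1$. If $j<\ell$ the same inequality makes
the excess nonpositive. -/
theorem BoundedEvanescent.corankWeight {ℓ M : ℕ} (h : BoundedEvanescent p ℓ M j e)
    (he : ∀ i, e i < p) (h₁ : 1 < μ) (hp : μ < p) (hμ : (p - μ) * μ ^ ℓ ≤ μ - 1) :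
    CorankWeight p μ M ((p - μ) / (μ - 1)) j e := by
  refine ⟨h.1, ?_⟩
  have h₀ : 0 < μ - 1 := sub_pos.mpr h₁
  have hT := sub_one_mul_sum_sub_one p j μ
  have hle : ∀ i, (e i : ℝ) ≤ p - 1 := fun i => by
    rw [le_sub_iff_add_le]
    exact_mod_cast he i
  suffices (μ - 1) * ∑ i ∈ Finset.range j, (e i : ℝ) * μ ^ i + (p - μ) ≤ (μ - 1) * μ ^ j by
    rw [← mul_le_mul_iff_right₀ h₀, mul_add, mul_div_cancel₀ _ h₀.ne']
    exact this
  rcases h.2 with hj | ⟨i, hij, hi, hei⟩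
  · have hS : ∑ i ∈ Finset.range j, (e i : ℝ) * μ ^ i ≤
        ∑ i ∈ Finset.range j, ((p : ℝ) - 1) * μ ^ i :=
      Finset.sum_le_sum fun i _ => mul_le_mul_of_nonneg_right (hle i) (by positivity)
    have hS' := mul_le_mul_of_nonneg_left hS h₀.le
    have hpow : (p - μ) * μ ^ j ≤ (p - μ) * μ ^ ℓ :=
      mul_le_mul_of_nonneg_left (pow_le_pow_right₀ h₁.le hj.le) (sub_pos.mpr hp).le
    linarith
  · have hS : ∑ i ∈ Finset.range j, (e i : ℝ) * μ ^ i + μ ^ i ≤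
        ∑ i ∈ Finset.range j, ((p : ℝ) - 1) * μ ^ i := by
      rw [← Finset.add_sum_erase _ _ (Finset.mem_range.mpr hij),
        ← Finset.add_sum_erase (a := i) _ (fun i => ((p : ℝ) - 1) * μ ^ i)
          (Finset.mem_range.mpr hij)]
      have hS' : ∑ l ∈ (Finset.range j).erase i, (e l : ℝ) * μ ^ l ≤
          ∑ l ∈ (Finset.range j).erase i, ((p : ℝ) - 1) * μ ^ l :=
        Finset.sum_le_sum fun i _ => mul_le_mul_of_nonneg_right (hle i) (by positivity)
      have hei' : (e i : ℝ) + 1 ≤ p - 1 := by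
        rw [le_sub_iff_add_le]
        exact_mod_cast (by omega : e i + 1 + 1 ≤ p)
      have := mul_le_mul_of_nonneg_right hei' (by positivity : 0 ≤ μ ^ i)
      linarith
    have hS' := mul_le_mul_of_nonneg_left hS h₀.le
    have hpow : (p - μ) * μ ^ j ≤ (p - μ) * μ ^ (ℓ + i) :=
      mul_le_mul_of_nonneg_left (pow_le_pow_right₀ h₁.le (by omega)) (sub_pos.mpr hp).le
    have hpow' : (p - μ) * μ ^ (ℓ + i) ≤ (μ - 1) * μ ^ i := by
      rw [pow_add, ← mul_assoc]
      exact mul_le_mul_of_nonneg_right hμ (by positivity)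
    linarith

/-- The full monomial weighs at least $\mu^j-1$, because $\mu<p$. The corank allows at most $M$
missing factors, each of weight at most $\mu^j$, so $w\le 1+M\mu^j$. -/
theorem CorankWeight.le {M : ℕ} {w : ℝ} (h : CorankWeight p μ M w j e) (he : ∀ i, e i < p)
    (h₁ : 1 < μ) (hp : μ < p) : w ≤ (M + 1) * μ ^ j := by
  have h₀ : 0 < μ - 1 := sub_pos.mpr h₁
  have hpow : 1 ≤ μ ^ j := one_le_pow₀ h₁.le
  have hT : μ ^ j - 1 ≤ ∑ i ∈ Finset.range j, ((p : ℝ) - 1) * μ ^ i := by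
    rw [← mul_le_mul_iff_right₀ h₀, sub_one_mul_sum_sub_one]
    exact mul_le_mul_of_nonneg_right (by linarith) (by linarith)
  have hle : ∀ i, (0 : ℝ) ≤ p - 1 - e i := fun i => by
    rw [sub_nonneg, le_sub_iff_add_le]
    exact_mod_cast he i
  have hS : ∑ i ∈ Finset.range j, ((p : ℝ) - 1 - e i) * μ ^ i ≤
      ∑ i ∈ Finset.range j, ((p : ℝ) - 1 - e i) * μ ^ j :=
    Finset.sum_le_sum fun i hi => mul_le_mul_of_nonneg_left
      (pow_le_pow_right₀ h₁.le (Finset.mem_range.mp hi).le) (hle i)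
  have hM : ∑ i ∈ Finset.range j, ((p : ℝ) - 1 - e i) ≤ M := by
    have hc : (((p - 1 : ℕ) : ℝ)) * j ≤ ∑ i ∈ Finset.range j, (e i : ℝ) + M := by
      exact_mod_cast h.1
    rw [Nat.cast_pred ((Nat.zero_le _).trans_lt (he 0))] at hc
    rw [Finset.sum_sub_distrib, Finset.sum_const, Finset.card_range, nsmul_eq_mul]
    linarith
  rw [← Finset.sum_mul] at hS
  have hM' := mul_le_mul_of_nonneg_right hM (by positivity : 0 ≤ μ ^ j)
  simp only [sub_mul, Finset.sum_sub_distrib] at hS hT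
  have := h.2
  simp only [sub_mul, Finset.sum_sub_distrib] at hM'
  linarith

theorem CorankWeight.lt_level {M N : ℕ} {w : ℝ} (h : CorankWeight p μ M w j e)
    (he : ∀ i, e i < p) (h₁ : 1 < μ) (hp : μ < p) (hw : (M + 1) * μ ^ N < w) : N < j := by
  by_contra hj
  have := h.le he h₁ hp
  have hpow : μ ^ j ≤ μ ^ N := pow_le_pow_right₀ h₁.le (not_lt.mp hj)
  have := mul_le_mul_of_nonneg_left hpow (by positivity : (0 : ℝ) ≤ M + 1)
  linarith

theorem weight_of_add_single_eq {i : ℕ} {v w : ℝ} (hij : i < j) (he : ∀ l, i ≤ l → e l = 0)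
    (h : g + Pi.single i 1 = e + f)
    (hew : ∑ l ∈ Finset.range i, (e l : ℝ) * μ ^ l + w ≤ μ ^ i)
    (hfv : ∑ l ∈ Finset.range j, (f l : ℝ) * μ ^ l + v ≤ μ ^ j) :
    ∑ l ∈ Finset.range j, (g l : ℝ) * μ ^ l + (v + w) ≤ μ ^ j := by
  have := sum_mul_of_add_single_eq (fun l => μ ^ l) hij he h
  linarith

theorem CorankWeight.carries {M M₁ : ℕ} {v w : ℝ} :
    Carries p (CorankWeight p μ M w) j (CorankWeight p μ M₁ v j)
      (CorankWeight p μ (M₁ + 1) (v + w) j) := by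
  intro i hij e f g he hew _ hf _ _ _ h
  refine ⟨?_, weight_of_add_single_eq hij he h hew.2 hf.2⟩
  have h₁ := sum_of_add_single_eq hij he h
  have h₂ := hf.1
  omega

/-- The weight bound forces $i>N$, whence $|e|\ge(p-1)i-M\ge1$. This compensates the factor removed
by $\partial_i$, and the corank does not grow. -/
theorem CorankWeight.carries_of_lt {M M₁ N : ℕ} {v w : ℝ} (h₁ : 1 < μ) (hp : μ < p)
    (hMN : M ≤ (p - 1) * N) (hw : (M + 1) * μ ^ N < w) :
    Carries p (CorankWeight p μ M w) j (CorankWeight p μ M₁ v j)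
      (CorankWeight p μ M₁ (v + w) j) := by
  intro i hij e f g he hew _ hf hep _ _ h
  refine ⟨?_, weight_of_add_single_eq hij he h hew.2 hf.2⟩
  have hNi := hew.lt_level hep h₁ hp hw
  have hp' : 1 < p := by exact_mod_cast h₁.trans hp
  have : (p - 1) * (N + 1) ≤ (p - 1) * i := Nat.mul_le_mul_left _ hNi
  rw [mul_add, mul_one] at this
  have h₂ := sum_of_add_single_eq hij he h
  have h₃ := hf.1
  have h₄ := hew.1
  omega

/-- In the first $i$ variables both $e$ and $f$ have degree at least $(p-1)i-M$, while $g=e+f$ is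
reduced there and has degree at most $(p-1)i$. So $(p-1)i\le 2M$, against $i>N$. -/
theorem CorankWeight.carries_false {M N : ℕ} {v w : ℝ} (h₁ : 1 < μ) (hp : μ < p)
    (hMN : 2 * M ≤ (p - 1) * N) (hw : (M + 1) * μ ^ N < w) :
    Carries p (CorankWeight p μ M w) j (CorankWeight p μ M v j) (fun _ => False) := by
  intro i hij e f g he hew _ hf hep hfp hgp h
  have hNi := hew.lt_level hep h₁ hp hw
  have hp' : 1 < p := by exact_mod_cast h₁.trans hp
  have hi : (p - 1) * (N + 1) ≤ (p - 1) * i := Nat.mul_le_mul_left _ hNi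
  rw [mul_add, mul_one] at hi
  have hf_sum : ∑ l ∈ Finset.range j, f l ≤
      ∑ l ∈ Finset.range i, f l + (j - i) * (p - 1) := by
    rw [← Finset.sum_range_add_sum_Ico _ hij.le, ← Nat.card_Ico]
    refine Nat.add_le_add_left (Finset.sum_le_card_nsmul _ _ _ fun l _ => ?_) _
    exact Nat.le_sub_one_of_lt (hfp l)
  have hef : ∑ l ∈ Finset.range i, e l + ∑ l ∈ Finset.range i, f l ≤ i * (p - 1) := by
    rw [← Finset.sum_add_distrib]
    refine (Finset.sum_le_card_nsmul _ _ (p - 1) fun l hl => ?_).trans (by simp)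
    have := congrFun h l
    rw [Pi.add_apply, Pi.add_apply, Pi.single_eq_of_ne (Finset.mem_range.mp hl).ne] at this
    have := hgp l
    omega
  have hj : (p - 1) * j = (p - 1) * i + (j - i) * (p - 1) := by
    rw [mul_comm (j - i), ← mul_add, Nat.add_sub_cancel' hij.le]
  have h₂ := hf.1
  have h₃ := hew.1
  rw [mul_comm i] at hef
  omega

end Weight

/-! ### Growth of weight under $p$-th powers, and nilpotency -/

section Nil

variable {k : Type*} [CommRing k] {p : ℕ} [Fact p.Prime] [CharP k p] {μ : ℝ}

theorem HasSupport.pMap_corankWeight {M : ℕ} {w : ℝ} {a : W k (Alphabet k p)}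
    (ha : HasSupport (CorankWeight p μ M w) a) :
    HasSupport (CorankWeight p μ (M + (p - 1)) (p * w)) (SelfSimilar.pMap p a) := by
  have hp : 0 < p := (Fact.out : p.Prime).pos
  have h := ha.pMap (fun t => CorankWeight p μ (M + t) ((t + 1) * w))
    (fun j e h => by simpa using h) (fun t j _ => by
      have := CorankWeight.carries (p := p) (j := j) (μ := μ) (M := M) (M₁ := M + t)
        (v := (t + 1) * w) (w := w)
      convert this using 2 <;> push_cast <;> ring)
  rwa [Nat.cast_pred hp, sub_add_cancel] at h

theorem HasSupport.pMap_corankWeight_of_lt {M N : ℕ} {w : ℝ} {a : W k (Alphabet k p)}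
    (h₁ : 1 < μ) (hp : μ < p) (hMN : M ≤ (p - 1) * N) (hw : (M + 1) * μ ^ N < w)
    (ha : HasSupport (CorankWeight p μ M w) a) :
    HasSupport (CorankWeight p μ M (p * w)) (SelfSimilar.pMap p a) := by
  have hp₀ : 0 < p := (Fact.out : p.Prime).pos
  have h := ha.pMap (fun t => CorankWeight p μ M ((t + 1) * w))
    (fun j e h => by simpa using h) (fun t j _ => by
      have := CorankWeight.carries_of_lt (j := j) (M₁ := M) (v := (t + 1) * w) h₁ hp hMN hw
      convert this using 2
      push_cast
      ring)
  rwa [Nat.cast_pred hp₀, sub_add_cancel] at h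

theorem HasSupport.pMap_eq_zero {M N : ℕ} {w : ℝ} {a : W k (Alphabet k p)}
    (h₁ : 1 < μ) (hp : μ < p) (hMN : 2 * M ≤ (p - 1) * N) (hw : (M + 1) * μ ^ N < w)
    (ha : HasSupport (CorankWeight p μ M w) a) : SelfSimilar.pMap p a = 0 := by
  have hp₁ : p.Prime := Fact.out
  have : NeZero p := ⟨hp₁.ne_zero⟩
  have : Nontrivial k := CharP.nontrivial_of_char_ne_one hp₁.ne_one
  -- Already $a^2$ kills every variable, so the support is empty for $t>0$, and $p-1>0$.
  have h := ha.pMap (fun t j e => t = 0 ∧ CorankWeight p μ M w j e) (fun j e h => ⟨rfl, h⟩)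
    (fun t j _ i hij e f g he hew hf hfw hep hfp hgp hadd =>
      (CorankWeight.carries_false h₁ hp hMN hw i hij e f g he hew hf hfw.2 hep hfp hgp hadd).elim)
  exact (h.mono fun j e _ _ he => (Nat.sub_pos_of_lt hp₁.one_lt).ne' he.1).eq_zero

theorem HasSupport.isNil {M : ℕ} {c : ℝ} {a : W k (Alphabet k p)}
    (h₁ : 1 < μ) (hp : μ < p) (hc : 0 < c) (ha : HasSupport (CorankWeight p μ M c) a) :
    IsNil p a := by
  have hp₁ : p.Prime := Fact.out
  have hp₀ : (0 : ℝ) < p := by exact_mod_cast hp₁.pos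
  have hp₂ : (1 : ℝ) < p := h₁.trans hp
  have hμ₀ : 0 < μ := one_pos.trans h₁
  have hpow : ∀ s : ℕ, HasSupport (CorankWeight p μ (M + s * (p - 1)) (p ^ s * c))
      ((SelfSimilar.pMap p)^[s] a) := by
    intro s
    induction s with
    | zero => simpa using ha
    | succ s ih =>
      rw [Function.iterate_succ_apply']
      have h := ih.pMap_corankWeight
      rwa [← mul_assoc, ← pow_succ', add_assoc, ← Nat.succ_mul] at h
  -- The threshold level is $N=M+s$, chosen so that the corank $M+s(p-1)$ is at most $(p-1)N$. Both
  -- sides are compared after division by $p^s$: $s(\mu/p)^s\to0$.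
  obtain ⟨s, hs⟩ : ∃ s : ℕ,
      (((M + s * (p - 1) : ℕ) : ℝ) + 1) * μ ^ (M + s) < p ^ s * c := by
    have hr₀ : 0 ≤ μ / p := by positivity
    have hr₁ : μ / p < 1 := (div_lt_one hp₀).mpr hp
    have hlim : Filter.Tendsto (fun s : ℕ => μ ^ M * ((M + 1) * (μ / p) ^ s +
        ((p - 1 : ℕ) : ℝ) * (s * (μ / p) ^ s))) Filter.atTop (nhds 0) := by
      simpa using (((tendsto_pow_atTop_nhds_zero_of_lt_one hr₀ hr₁).const_mul ((M : ℝ) + 1)).add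
        ((tendsto_self_mul_const_pow_of_lt_one hr₀ hr₁).const_mul
          ((p - 1 : ℕ) : ℝ))).const_mul (μ ^ M)
    obtain ⟨s, hs⟩ := (hlim.eventually (gt_mem_nhds hc)).exists
    refine ⟨s, ?_⟩
    have h := mul_lt_mul_of_pos_left hs (pow_pos hp₀ s)
    refine lt_of_eq_of_lt ?_ h
    rw [div_pow]
    push_cast
    field_simp
    ring
  have hMs : M + s * (p - 1) ≤ (p - 1) * (M + s) := by
    rw [mul_add, mul_comm s]
    exact Nat.add_le_add_right (Nat.le_mul_of_pos_left _ (Nat.sub_pos_of_lt hp₁.one_lt)) _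
  have hws := hpow s
  generalize M + s * (p - 1) = M' at hs hMs hws
  have hw₀ : 0 < (p : ℝ) ^ s * c := by positivity
  generalize (p : ℝ) ^ s * c = w at hs hws hw₀
  -- From here on the corank is frozen at $M'$ while the weight bound $p^tw$ grows without limit.
  have hpow' : ∀ t : ℕ, HasSupport (CorankWeight p μ M' (p ^ t * w))
      ((SelfSimilar.pMap p)^[t] ((SelfSimilar.pMap p)^[s] a)) := by
    intro t
    induction t with
    | zero => simpa using hws
    | succ t ih =>
      rw [Function.iterate_succ_apply', pow_succ', mul_assoc]
      refine ih.pMap_corankWeight_of_lt h₁ hp hMs (hs.trans_le ?_)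
      exact le_mul_of_one_le_left hw₀.le (one_le_pow₀ hp₂.le)
  -- Level $N=2M'$ is enough for `HasSupport.pMap_eq_zero`, since $p-1\ge1$.
  obtain ⟨t, ht⟩ := ((tendsto_pow_atTop_atTop_of_one_lt hp₂).atTop_mul_const hw₀).eventually
    (Filter.eventually_gt_atTop (((M' : ℝ) + 1) * μ ^ (2 * M'))) |>.exists
  refine ⟨t + 1 + s, ?_⟩
  rw [Function.iterate_add_apply, Function.iterate_succ_apply']
  exact (hpow' t).pMap_eq_zero h₁ hp
    (Nat.le_mul_of_pos_left _ (Nat.sub_pos_of_lt hp₁.one_lt)) ht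

theorem isNil_of_boundedEvanescent {ℓ M : ℕ} {a : W k (Alphabet k p)}
    (ha : HasSupport (BoundedEvanescent p ℓ M) a) : IsNil p a := by
  have hp₂ : (2 : ℝ) ≤ p := by exact_mod_cast (Fact.out : p.Prime).two_le
  have hq₁ : (1 : ℝ) ≤ (p : ℝ) ^ ℓ := one_le_pow₀ (by linarith)
  -- With $\mu=p-\delta$, the required $\delta\mu^\ell\le\mu-1$ follows from $\delta
  -- p^\ell=1-\delta\le p-1-\delta$.
  obtain ⟨δ, hδ⟩ : ∃ δ : ℝ, δ = 1 / ((p : ℝ) ^ ℓ + 1) := ⟨_, rfl⟩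
  have hδ₀ : 0 < δ := by rw [hδ]; positivity
  have hδ₁ : δ * (p : ℝ) ^ ℓ + δ = 1 := by
    rw [hδ]
    field_simp
  have hδ₂ : δ ≤ δ * (p : ℝ) ^ ℓ := le_mul_of_one_le_right hδ₀.le hq₁
  have h₁ : 1 < p - δ := by linarith
  have hp : (p : ℝ) - δ < p := by linarith
  refine HasSupport.isNil h₁ hp (div_pos (sub_pos.mpr hp) (sub_pos.mpr h₁))
    (ha.mono fun j e he _ h => h.corankWeight he h₁ hp ?_)
  have : δ * (p - δ) ^ ℓ ≤ δ * (p : ℝ) ^ ℓ :=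
    mul_le_mul_of_nonneg_left (pow_le_pow_left₀ (by linarith) hp.le ℓ) hδ₀.le
  rw [sub_sub_cancel]
  linarith

/-! ### The restricted Lie subalgebra containing all generators -/

variable (k p) in
/-- The Lie subalgebra of the elements with bounded evanescent exponents. -/
def boundedEvanescentSubalgebra (ℓ : ℕ) : LieSubalgebra k (W k (Alphabet k p)) where
  carrier := {a | ∃ M, HasSupport (BoundedEvanescent p ℓ M) a}
  zero_mem' := ⟨0, HasSupport.zero⟩
  add_mem' := by
    rintro a b ⟨M, ha⟩ ⟨N, hb⟩
    exact ⟨max M N, (ha.mono fun _ _ _ _ h => h.mono (le_max_left M N)).add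
      (hb.mono fun _ _ _ _ h => h.mono (le_max_right M N))⟩
  smul_mem' := fun c a ⟨M, ha⟩ => ⟨M, ha.smul c⟩
  lie_mem' := by
    rintro a b ⟨M, ha⟩ ⟨N, hb⟩
    exact ⟨max M N + 1, (ha.mono fun _ _ _ _ h => h.mono (le_max_left M N)).lie
      (hb.mono fun _ _ _ _ h => h.mono (le_max_right M N))
      fun j => BoundedEvanescent.carries le_rfl⟩

theorem pMap_mem_boundedEvanescentSubalgebra {ℓ : ℕ} {a : W k (Alphabet k p)}
    (ha : a ∈ boundedEvanescentSubalgebra k p ℓ) :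
    pMap p a ∈ boundedEvanescentSubalgebra k p ℓ := by
  obtain ⟨M, ha⟩ := ha
  exact ⟨M + (p - 1), ha.pMap (fun t => BoundedEvanescent p ℓ (M + t)) (fun _ _ h => h)
    fun t j _ => BoundedEvanescent.carries le_rfl⟩

end Nil

end SelfSimilar

end

theorem mainTheorem1 {k : Type*} [CommRing k] (p : ℕ) [Fact p.Prime] [CharP k p] (ℓ : ℕ)
    (S : Set (SelfSimilar.W k (SelfSimilar.Alphabet k p)))
    (hS : ∀ a ∈ S, SelfSimilar.IsBounded a ∧ SelfSimilar.IsEvanescent ℓ a) :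
    ∀ a ∈ SelfSimilar.restrictedSpan p S, SelfSimilar.IsNil p a := by
  intro a ha
  have hle : SelfSimilar.restrictedSpan p S ≤ SelfSimilar.boundedEvanescentSubalgebra k p ℓ :=
    sInf_le ⟨fun b hb => SelfSimilar.exists_hasSupport (hS b hb).1 (hS b hb).2,
      fun b hb => SelfSimilar.pMap_mem_boundedEvanescentSubalgebra hb⟩
  obtain ⟨M, h⟩ := hle ha
  exact SelfSimilar.isNil_of_boundedEvanescent h
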